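/- Let $I_1,I_2$ be disjoint finite index sets, $I=I_1\cup I_2$, $a_i\in\mathbb R^n$, $b_i\in\mathbb R$ $(i\in I)$, $c\in\mathbb R^n$, $$\Theta=\{x\in\mathbb R^n: \langle a_i,x\rangle\le b_i\ \forall i\in I_1\},\qquad \mathcal C=\{x\in\mathbb R^n:\langle a_i,x\rangle\le b_i\ \forall i\in I_2\},$$ and $f:\mathbb R^n\to\mathbb R\cup\{\infty\}$ (a function given on $\Theta$ only is extended by $\infty$). Consider the bilevel problem $$\text{(SBLP)}\qquad \min f(x)\quad\text{s.t. } x\in\mathcal S\cap\mathcal C,\qquad \mathcal S=\operatorname{argmin}\{c^\top x: x\in\Theta\}.$$ *Normal cones.* For subsets $\Omega,C$ of a Euclidean space put $\mathcal R(x,C)=\{v:\exists p>0,\ x+pv\in C\}$; $\hat N(x,\Omega)$ is the Fréchet normal cone, i.e. the set of $v$ with $\limsup_{u\to x,\,u\in\Omega}\langle v,u-x\rangle/\|u-x\|\le 0$; $\hat N_C(x,\Omega)=\hat N(x,\Omega\cap C)\cap\mathcal R(x,C)$; and $N_C(x,\Omega)$ is the set of all limits $v=\lim v_k$ with $v_k\in\hat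 N_C(x_k,\Omega)$, $x_k\in\Omega\cap C$, $x_k\to x$. For $x\in \mathcal C$ with $f(x)<\infty$, $$\partial_{\mathcal C}f(x)=\{v\in\mathbb R^n: (v,-1)\in N_{\mathcal C\times\mathbb R}((x,f(x)),\operatorname{epi}f)\}.$$ Let $G(x)=c+N(x,\Theta)$ for $x\in\Theta$, with $N(x,\Theta)$ the limiting normal cone (the outer limit of $\operatorname{cone}[u-\Pi(u,\Theta)]$ as $u\to x$, $\Pi$ being the Euclidean projection), and $G(x)=\emptyset$ for $x\notin\Theta$. A local solution $\bar x$ of (SBLP) is *robust* if $(\bar x,0)$ is a local solution of $\min f(x)$ s.t. $y\in G(x)$, $x\in\mathcal C$. *Normal-densedness.* Sets $\{\Omega_1,\Omega_2\}$ are normal-densed in $\{C_1,C_2\}$ at $\bar w$ if, with $\Omega=\Omega_1\cap\Omega_2$ and $C=C_1\cap C_2$, whenever $w_{ik}\to\bar w$ in $\Omega_i\cap C_i$, $w_k\to\bar w$ in $\Omega\cap\operatorname{bd}C$, $w_{ik}^*\in\hat N(w_{ik},\Omega_i\cap C_i)$, $w_{ik}^*\to w_i^*$ $(i=1,2)$,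 and $w_k^*\in\mathcal R(w_k,C)$, $w_k^*\to w_1^*+w_2^*$, there are $\tilde w_{ik}\to\bar w$ in $\Omega_i\cap C_i$ and $\tilde w_{ik}^*\in\hat N_{C_i}(\tilde w_{ik},\Omega_i)$ with $\tilde w_{ik}^*\to\tilde w_i^*$ $(i=1,2)$, $\tilde w_1^*+\tilde w_2^*=w_1^*+w_2^*$, and $\max\{\|\tilde w_1^*\|,\|\tilde w_2^*\|\}>0$ whenever $\max\{\|w_1^*\|,\|w_2^*\|\}>0$. *Active indices.* Let $\bar I_j=\{i\in I_j:\langle a_i,\bar x\rangle=b_i\}$ $(j=1,2)$; for $Q\subset I$ let $C_Q=\{x:\langle a_i,x\rangle=b_i\ \forall i\in Q,\ \langle a_i,x\rangle<b_i\ \forall i\in I\setminus Q\}$ and $\mathcal T_Q=\{u:\langle a_i,u\rangle\le0\ \forall i\in Q\}$; let $\mathcal I_2=\{T\subset\bar I_2: C_{\bar I_1\cup T}\neq\emptyset\}$. **Statement.** Let $\bar x$, with $f(\bar x)<\infty$, be a robust local solution of (SBLP). Suppose that $$\Big(\operatorname{cone}\{a_i: i\in\bar I_2\}+\operatorname{span}\{a_i: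 i\in\bar I_1\}\Big)\cap\bigcup_{T\in\mathcal I_2}\mathcal T_T=\{0\},$$ and that $\{\Omega_1,\Omega_2\}$ are normal-densed in $\{\mathcal C\times\mathbb R^{n}\times\mathbb R,\ \mathcal C\times\mathbb R^{n}\times\mathbb R\}$ at $(\bar x,0,f(\bar x))$, where $\Omega_1=\{(x,y,z)\in\mathbb R^n\times\mathbb R^n\times\mathbb R:(x,z)\in\operatorname{epi}f\}$ and $\Omega_2=\operatorname{gph}G\times\mathbb R$. Then $0\in\partial_{\mathcal C}f(\bar x)$. -/

import Mathlib

open Filter Topology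
open scoped Pointwise

namespace SBLP

/-! ### Normal cones in a real inner product space -/

/-- The radial cone `R(x, Ω) = {v | ∃ p > 0, x + p v ∈ Ω}`. -/
def radialCone {V : Type*} [NormedAddCommGroup V] [InnerProductSpace ℝ V]
    (x : V) (Ω : Set V) : Set V :=
  {v | ∃ p : ℝ, 0 < p ∧ x + p • v ∈ Ω}

/-- The Fréchet normal cone `N̂(x, Ω)`: all `v` such that the upper limit of
`⟪v, u - x⟫ / ‖u - x‖`, as `u → x` in `Ω` (with `u ≠ x`), is at most `0`. -/
def frechetNormalCone {V : Type*} [NormedAddCommGroup V] [InnerProductSpace ℝ V]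
    (x : V) (Ω : Set V) : Set V :=
  {v | ∀ ε : ℝ, 0 < ε → ∀ᶠ u in 𝓝[Ω] x, inner ℝ v (u - x) ≤ ε * ‖u - x‖}

/-- The Fréchet normal cone `N̂_C(x, Ω)` to `Ω` at `x` with respect to `C`. -/
def frechetNormalConeWrt {V : Type*} [NormedAddCommGroup V] [InnerProductSpace ℝ V]
    (C : Set V) (x : V) (Ω : Set V) : Set V :=
  {v | (∃ p : ℝ, 0 < p ∧ x + p • v ∈ C) ∧
    ∀ ε : ℝ, 0 < ε → ∀ᶠ u in 𝓝[Ω ∩ C] x, inner ℝ v (u - x) ≤ ε * ‖u - x‖}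

/-- The limiting normal cone `N_C(x, Ω)` to `Ω` at `x` with respect to `C`: the sequential outer
limit of `N̂_C(u, Ω)` as `u → x` in `Ω ∩ C`. -/
def limitingNormalConeWrt {V : Type*} [NormedAddCommGroup V] [InnerProductSpace ℝ V]
    (C : Set V) (x : V) (Ω : Set V) : Set V :=
  {v | ∃ (xs vs : ℕ → V), (∀ k, xs k ∈ Ω ∩ C) ∧ Tendsto xs atTop (𝓝 x) ∧
    (∀ k, vs k ∈ frechetNormalConeWrt C (xs k) Ω) ∧ Tendsto vs atTop (𝓝 v)}

/-- The set `Π(x, Ω)` of Euclidean projectors (closest points) of `x` onto `Ω`. -/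
def projectors {V : Type*} [NormedAddCommGroup V] [InnerProductSpace ℝ V]
    (x : V) (Ω : Set V) : Set V :=
  {u | u ∈ Ω ∧ ‖u - x‖ = Metric.infDist x Ω}

/-- The limiting normal cone `N(x, Ω)`: the sequential outer limit of `cone [u - Π(u, Ω)]` as
`u → x`. -/
def limitingNormalCone {V : Type*} [NormedAddCommGroup V] [InnerProductSpace ℝ V]
    (x : V) (Ω : Set V) : Set V :=
  {v | ∃ (xs vs : ℕ → V), Tendsto xs atTop (𝓝 x) ∧
    (∀ k, ∃ t : ℝ, 0 ≤ t ∧ ∃ u ∈ projectors (xs k) Ω, vs k = t • (xs k - u)) ∧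
    Tendsto vs atTop (𝓝 v)}

/-- `{Ω₁, Ω₂}` are normal-densed in `{C₁, C₂}` at `x`. -/
def NormalDensed {V : Type*} [NormedAddCommGroup V] [InnerProductSpace ℝ V]
    (Ω₁ Ω₂ C₁ C₂ : Set V) (x : V) : Prop :=
  ∀ (x₁ x₂ xs v₁ v₂ vs : ℕ → V) (w₁ w₂ : V),
    (∀ k, x₁ k ∈ Ω₁ ∩ C₁) → Tendsto x₁ atTop (𝓝 x) →
    (∀ k, x₂ k ∈ Ω₂ ∩ C₂) → Tendsto x₂ atTop (𝓝 x) →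
    (∀ k, xs k ∈ (Ω₁ ∩ Ω₂) ∩ frontier (C₁ ∩ C₂)) → Tendsto xs atTop (𝓝 x) →
    (∀ k, v₁ k ∈ frechetNormalCone (x₁ k) (Ω₁ ∩ C₁)) → Tendsto v₁ atTop (𝓝 w₁) →
    (∀ k, v₂ k ∈ frechetNormalCone (x₂ k) (Ω₂ ∩ C₂)) → Tendsto v₂ atTop (𝓝 w₂) →
    (∀ k, vs k ∈ radialCone (xs k) (C₁ ∩ C₂)) → Tendsto vs atTop (𝓝 (w₁ + w₂)) →
    ∃ (y₁ y₂ u₁ u₂ : ℕ → V) (z₁ z₂ : V),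
      (∀ k, y₁ k ∈ Ω₁ ∩ C₁) ∧ Tendsto y₁ atTop (𝓝 x) ∧
      (∀ k, y₂ k ∈ Ω₂ ∩ C₂) ∧ Tendsto y₂ atTop (𝓝 x) ∧
      (∀ k, u₁ k ∈ frechetNormalConeWrt C₁ (y₁ k) Ω₁) ∧ Tendsto u₁ atTop (𝓝 z₁) ∧
      (∀ k, u₂ k ∈ frechetNormalConeWrt C₂ (y₂ k) Ω₂) ∧ Tendsto u₂ atTop (𝓝 z₂) ∧
      z₁ + z₂ = w₁ + w₂ ∧
      (0 < max ‖w₁‖ ‖w₂‖ → 0 < max ‖z₁‖ ‖z₂‖)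

/-! ### Extended-real-valued functions on `ℝⁿ`

Products carry the Euclidean structure (`WithLp 2`), so that the scalar product of a product space
is the sum of the scalar products. -/

/-- The epigraph of `f : ℝⁿ → ℝ ∪ {∞}`, a subset of `ℝⁿ × ℝ`. -/
def epigraph {n : ℕ} (f : EuclideanSpace ℝ (Fin n) → WithTop ℝ) :
    Set (WithLp 2 (EuclideanSpace ℝ (Fin n) × ℝ)) :=
  {p | f p.fst ≤ (p.snd : WithTop ℝ)}

/-- The limiting subdifferential `∂_C f(x)` with respect to `C`; it is empty unless `x ∈ C` and
`f x` is finite. -/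
def subdifferentialWrt {n : ℕ} (C : Set (EuclideanSpace ℝ (Fin n)))
    (f : EuclideanSpace ℝ (Fin n) → WithTop ℝ) (x : EuclideanSpace ℝ (Fin n)) :
    Set (EuclideanSpace ℝ (Fin n)) :=
  {v | x ∈ C ∧ ∃ r : ℝ, f x = (r : WithTop ℝ) ∧
    WithLp.toLp 2 (v, (-1 : ℝ)) ∈
      limitingNormalConeWrt {p : WithLp 2 (EuclideanSpace ℝ (Fin n) × ℝ) | p.fst ∈ C}
        (WithLp.toLp 2 (x, r)) (epigraph f)}

/-- `x` is a local solution of the problem of minimizing `φ` over `S`. -/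
def IsLocalSolution {V : Type*} [TopologicalSpace V] (φ : V → WithTop ℝ) (S : Set V) (x : V) :
    Prop :=
  x ∈ S ∧ IsLocalMinOn φ S x

/-! ### The simple bilevel problem with linear lower level

The index set is `I = I₁ ⊔ I₂` with `I₁ = Fin ℓ₁` and `I₂ = Fin ℓ₂`. -/

/-- The lower-level polyhedron `Θ = {x | ⟪aᵢ, x⟫ ≤ bᵢ for all i ∈ I₁}`. -/
def Theta {n ℓ₁ ℓ₂ : ℕ} (a : Fin ℓ₁ ⊕ Fin ℓ₂ → EuclideanSpace ℝ (Fin n))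
    (b : Fin ℓ₁ ⊕ Fin ℓ₂ → ℝ) : Set (EuclideanSpace ℝ (Fin n)) :=
  {x | ∀ i : Fin ℓ₁, inner ℝ (a (Sum.inl i)) x ≤ b (Sum.inl i)}

/-- The upper-level polyhedron `C = {x | ⟪aᵢ, x⟫ ≤ bᵢ for all i ∈ I₂}`. -/
def CSet {n ℓ₁ ℓ₂ : ℕ} (a : Fin ℓ₁ ⊕ Fin ℓ₂ → EuclideanSpace ℝ (Fin n))
    (b : Fin ℓ₁ ⊕ Fin ℓ₂ → ℝ) : Set (EuclideanSpace ℝ (Fin n)) :=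
  {x | ∀ i : Fin ℓ₂, inner ℝ (a (Sum.inr i)) x ≤ b (Sum.inr i)}

/-- The solution set `argmin {⟪c, x⟫ | x ∈ Θ}` of the lower-level problem. -/
def lowerSolutions {n : ℕ} (c : EuclideanSpace ℝ (Fin n))
    (Θ : Set (EuclideanSpace ℝ (Fin n))) : Set (EuclideanSpace ℝ (Fin n)) :=
  {x | x ∈ Θ ∧ ∀ u ∈ Θ, inner ℝ c x ≤ inner ℝ c u}

/-- The normal cone mapping to `Θ`, with empty values outside `Θ`. -/
def normalConeMap {n : ℕ} (Θ : Set (EuclideanSpace ℝ (Fin n)))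
    (x : EuclideanSpace ℝ (Fin n)) : Set (EuclideanSpace ℝ (Fin n)) :=
  {v | x ∈ Θ ∧ v ∈ limitingNormalCone x Θ}

/-- The set-valued mapping `G(x) = c + N(x, Θ)`. -/
def G {n : ℕ} (c : EuclideanSpace ℝ (Fin n)) (Θ : Set (EuclideanSpace ℝ (Fin n)))
    (x : EuclideanSpace ℝ (Fin n)) : Set (EuclideanSpace ℝ (Fin n)) :=
  {y | ∃ v ∈ normalConeMap Θ x, y = c + v}

/-- `x` is a robust local solution of the bilevel problem
`min f(x)` subject to `x ∈ argmin {⟪c, u⟫ | u ∈ Θ} ∩ C`: it is a local solution, and `(x, 0)` is a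
local solution of the mixed problem `min f(x)` subject to `y ∈ G(x)`, `x ∈ C`. -/
def IsRobustLocalSolution {n : ℕ} (f : EuclideanSpace ℝ (Fin n) → WithTop ℝ)
    (c : EuclideanSpace ℝ (Fin n)) (Θ C : Set (EuclideanSpace ℝ (Fin n)))
    (x : EuclideanSpace ℝ (Fin n)) : Prop :=
  IsLocalSolution f (lowerSolutions c Θ ∩ C) x ∧
  IsLocalSolution (fun p : EuclideanSpace ℝ (Fin n) × EuclideanSpace ℝ (Fin n) => f p.1)
    {p | p.2 ∈ G c Θ p.1 ∧ p.1 ∈ C} (x, 0)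

/-! ### The relation on the active generators -/

/-- The active indices in `I₁` at `x`. -/
def active₁ {n ℓ₁ ℓ₂ : ℕ} (a : Fin ℓ₁ ⊕ Fin ℓ₂ → EuclideanSpace ℝ (Fin n))
    (b : Fin ℓ₁ ⊕ Fin ℓ₂ → ℝ) (x : EuclideanSpace ℝ (Fin n)) : Set (Fin ℓ₁ ⊕ Fin ℓ₂) :=
  {i | i ∈ Set.range Sum.inl ∧ inner ℝ (a i) x = b i}

/-- The active indices in `I₂` at `x`. -/
def active₂ {n ℓ₁ ℓ₂ : ℕ} (a : Fin ℓ₁ ⊕ Fin ℓ₂ → EuclideanSpace ℝ (Fin n))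
    (b : Fin ℓ₁ ⊕ Fin ℓ₂ → ℝ) (x : EuclideanSpace ℝ (Fin n)) : Set (Fin ℓ₁ ⊕ Fin ℓ₂) :=
  {i | i ∈ Set.range Sum.inr ∧ inner ℝ (a i) x = b i}

/-- The stratum `C_Q` of the points of `Θ ∩ C` whose set of active indices is exactly `Q`. -/
def stratum {n ℓ₁ ℓ₂ : ℕ} (a : Fin ℓ₁ ⊕ Fin ℓ₂ → EuclideanSpace ℝ (Fin n))
    (b : Fin ℓ₁ ⊕ Fin ℓ₂ → ℝ) (Q : Set (Fin ℓ₁ ⊕ Fin ℓ₂)) : Set (EuclideanSpace ℝ (Fin n)) :=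
  {x | (∀ i ∈ Q, inner ℝ (a i) x = b i) ∧ ∀ i ∉ Q, inner ℝ (a i) x < b i}

/-- The cone `T_Q = {u | ⟪aᵢ, u⟫ ≤ 0 for all i ∈ Q}`. -/
def coneT {n ℓ₁ ℓ₂ : ℕ} (a : Fin ℓ₁ ⊕ Fin ℓ₂ → EuclideanSpace ℝ (Fin n))
    (Q : Set (Fin ℓ₁ ⊕ Fin ℓ₂)) : Set (EuclideanSpace ℝ (Fin n)) :=
  {u | ∀ i ∈ Q, inner ℝ (a i) u ≤ 0}

/-- The family of all sets `T` of indices from `I₂` active at `x` for which the stratum of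
`I₁(x) ∪ T` is nonempty. -/
def familyI₂ {n ℓ₁ ℓ₂ : ℕ} (a : Fin ℓ₁ ⊕ Fin ℓ₂ → EuclideanSpace ℝ (Fin n))
    (b : Fin ℓ₁ ⊕ Fin ℓ₂ → ℝ) (x : EuclideanSpace ℝ (Fin n)) : Set (Set (Fin ℓ₁ ⊕ Fin ℓ₂)) :=
  {T | T ⊆ active₂ a b x ∧ (stratum a b (active₁ a b x ∪ T)).Nonempty}

/-- The relation
`(cone {aᵢ | i ∈ I₂(x)} + span {aᵢ | i ∈ I₁(x)}) ∩ ⋃_T T_T = {0}`, with `T` in `familyI₂`. -/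
def ActiveRelation {n ℓ₁ ℓ₂ : ℕ} (a : Fin ℓ₁ ⊕ Fin ℓ₂ → EuclideanSpace ℝ (Fin n))
    (b : Fin ℓ₁ ⊕ Fin ℓ₂ → ℝ) (x : EuclideanSpace ℝ (Fin n)) : Prop :=
  ((PointedCone.hull ℝ (a '' active₂ a b x) : Set (EuclideanSpace ℝ (Fin n))) +
      (Submodule.span ℝ (a '' active₁ a b x) : Set (EuclideanSpace ℝ (Fin n)))) ∩
    (⋃ T ∈ familyI₂ a b x, coneT a T) = {0}

/-! ### The sets in the normal-densedness condition, in `ℝⁿ × ℝⁿ × ℝ` -/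

/-- `Ω₁ = {(x, y, z) | (x, z) ∈ epi f}`. -/
def Omega₁ {n : ℕ} (f : EuclideanSpace ℝ (Fin n) → WithTop ℝ) :
    Set (WithLp 2 (EuclideanSpace ℝ (Fin n) × WithLp 2 (EuclideanSpace ℝ (Fin n) × ℝ))) :=
  {p | WithLp.toLp 2 (p.fst, p.snd.snd) ∈ epigraph f}

/-- `Ω₂ = gph G × ℝ`. -/
def Omega₂ {n : ℕ} (c : EuclideanSpace ℝ (Fin n)) (Θ : Set (EuclideanSpace ℝ (Fin n))) :
    Set (WithLp 2 (EuclideanSpace ℝ (Fin n) × WithLp 2 (EuclideanSpace ℝ (Fin n) × ℝ))) :=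
  {p | p.snd.fst ∈ G c Θ p.fst}

/-- The cylinder `C × ℝⁿ × ℝ`. -/
def cylinder {n : ℕ} (C : Set (EuclideanSpace ℝ (Fin n))) :
    Set (WithLp 2 (EuclideanSpace ℝ (Fin n) × WithLp 2 (EuclideanSpace ℝ (Fin n) × ℝ))) :=
  {p | p.fst ∈ C}

end SBLP

/-! The active relation makes the lower level locally invisible: near `xbar`, every point of the
upper-level polyhedron already solves the lower-level problem, so `xbar` minimizes `f` locally over
that polyhedron and Fermat's rule applies.

The crux is `ActiveRelation.inner_eq_zero`. Project a direction `d` that is feasible for the active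
upper-level constraints onto the cone `F` of those directions that also keep the active lower-level
constraints tight, and call the result `q`. The residual `d - q` lies in the polar of `F`, which by
Farkas is the cone plus span of the relation. It also lies in `T_T`, where `T` collects the active
upper-level constraints tight along `q`. The relation forces `d = q`.

Hence `u - xbar` is orthogonal to the active lower-level generators for every `u` of the upper-level
polyhedron. Since `c` vanishes on such directions, `u` near `xbar` is feasible and optimal for the
lower level (`ActiveRelation.eventually_mem_lowerSolutions`). -/

namespace SBLP

/-! ### Farkas' lemma and polars of finitely generated cones -/

section Farkas

variable {V : Type*} [NormedAddCommGroup V] [InnerProductSpace ℝ V]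

/-- Farkas' lemma: a linear inequality implied by finitely many homogeneous linear inequalities is
a nonnegative combination of them. -/
theorem exists_nonneg_sum_of_forall_inner_nonpos {ι : Type*} [DecidableEq ι] (s : Finset ι) :
    ∀ (a : ι → V) (b : V),
      (∀ x : V, (∀ i ∈ s, inner ℝ (a i) x ≤ 0) → inner ℝ b x ≤ 0) →
      ∃ t : ι → ℝ, (∀ i ∈ s, 0 ≤ t i) ∧ b = ∑ i ∈ s, t i • a i := by
  induction s using Finset.induction_on with
  | empty =>
    intro a b h
    have hb : inner ℝ b b ≤ 0 := h b (by simp)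
    exact ⟨0, by simp, by simpa using real_inner_self_nonpos.1 hb⟩
  | insert j s hj ih =>
    intro a b h
    -- Either `a j` is redundant and gets coefficient `0`, or some `x₀` satisfies the other
    -- inequalities and violates the conclusion, which forces `⟪a j, x₀⟫ > 0`.
    by_cases hs : ∀ x : V, (∀ i ∈ s, inner ℝ (a i) x ≤ 0) → inner ℝ b x ≤ 0
    · obtain ⟨t, ht, hb⟩ := ih a b hs
      refine ⟨Function.update t j 0, fun i hi => ?_, ?_⟩
      · rcases eq_or_ne i j with rfl | hij
        · simp
        · rw [Function.update_of_ne hij]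
          exact ht i ((Finset.mem_insert.1 hi).resolve_left hij)
      · rw [Finset.sum_insert hj, Function.update_self, zero_smul, zero_add, hb]
        refine Finset.sum_congr rfl fun i hi => ?_
        rw [Function.update_of_ne (ne_of_mem_of_not_mem hi hj)]
    · push Not at hs
      obtain ⟨x₀, hx₀, hb₀⟩ := hs
      have hj₀ : 0 < inner ℝ (a j) x₀ := by
        by_contra hneg
        refine absurd (h x₀ fun i hi => ?_) (not_le.2 hb₀)
        rcases Finset.mem_insert.1 hi with rfl | hi
        · exact not_lt.1 hneg
        · exact hx₀ i hi
      set α : ℝ := inner ℝ (a j) x₀ with hα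
      -- Eliminate `a j` by projecting all vectors along it onto the hyperplane `x₀ᗮ`. The adjoint
      -- moves `x` along `x₀` until `⟪a j, x⟫ = 0`, so the original implication applies to the moved
      -- point.
      obtain ⟨t, ht, hb⟩ := ih (fun i => a i - (inner ℝ (a i) x₀ / α) • a j)
        (b - (inner ℝ b x₀ / α) • a j) (by
          intro x hx
          have key : ∀ v : V, inner ℝ (v - (inner ℝ v x₀ / α) • a j) x =
              inner ℝ v (x - (inner ℝ (a j) x / α) • x₀) := by
            intro v
            simp only [inner_sub_left, inner_sub_right, real_inner_smul_left,
              real_inner_smul_right]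
            ring
          rw [key]
          refine h _ fun i hi => ?_
          rcases Finset.mem_insert.1 hi with rfl | hi
          · rw [inner_sub_right, real_inner_smul_right, ← hα, div_mul_cancel₀ _ hj₀.ne', sub_self]
          · rw [← key]
            exact hx i hi)
      -- This coefficient of `a j` results from undoing the projection; it is nonnegative because
      -- `⟪b, x₀⟫ > 0` and `⟪a i, x₀⟫ ≤ 0` on `s`.
      refine ⟨Function.update t j (inner ℝ b x₀ / α - ∑ i ∈ s, t i * (inner ℝ (a i) x₀ / α)),
        fun i hi => ?_, ?_⟩
      · rcases eq_or_ne i j with rfl | hij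
        · rw [Function.update_self, sub_nonneg]
          exact (Finset.sum_nonpos fun k hk => mul_nonpos_of_nonneg_of_nonpos (ht k hk)
            (div_nonpos_of_nonpos_of_nonneg (hx₀ k hk) hj₀.le)).trans (by positivity)
        · rw [Function.update_of_ne hij]
          exact ht i ((Finset.mem_insert.1 hi).resolve_left hij)
      · have hsum : ∑ i ∈ s, Function.update t j
            (inner ℝ b x₀ / α - ∑ i ∈ s, t i * (inner ℝ (a i) x₀ / α)) i • a i =
            ∑ i ∈ s, t i • a i :=
          Finset.sum_congr rfl fun i hi => by
            rw [Function.update_of_ne (ne_of_mem_of_not_mem hi hj)]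
        rw [Finset.sum_insert hj, Function.update_self, hsum]
        refine (sub_eq_iff_eq_add.1 hb).trans ?_
        simp only [smul_sub, Finset.sum_sub_distrib, smul_smul, ← Finset.sum_smul, sub_smul]
        abel

/-- The polar of `{x | ⟪v, x⟫ = 0 for v ∈ A, ⟪v, x⟫ ≤ 0 for v ∈ B}` is contained in
`cone B + span A`, for finite `A` and `B`. -/
theorem mem_hull_add_span_of_forall_inner_nonpos {A B : Set V} (hA : A.Finite) (hB : B.Finite)
    {u : V} (hu : ∀ x : V, (∀ v ∈ A, inner ℝ v x = 0) → (∀ v ∈ B, inner ℝ v x ≤ 0) →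
      inner ℝ u x ≤ 0) :
    u ∈ (PointedCone.hull ℝ B : Set V) + (Submodule.span ℝ A : Set V) := by
  classical
  -- Each equality is a pair of inequalities, given by `v` and `-v`; both generators land in the
  -- span.
  obtain ⟨t, ht, rfl⟩ := exists_nonneg_sum_of_forall_inner_nonpos
    (hB.toFinset ∪ (hA.toFinset ∪ hA.toFinset.image Neg.neg)) id u (by
      intro x hx
      refine hu x (fun v hv => le_antisymm ?_ ?_) (fun v hv => ?_)
      · exact hx v (by simp [hv])
      · have := hx (-v) (by simp [hv])
        simpa using this
      · exact hx v (by simp [hv]))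
  have hmem : ∀ v ∈ hB.toFinset ∪ (hA.toFinset ∪ hA.toFinset.image Neg.neg),
      t v • id v ∈ PointedCone.hull ℝ B ⊔ (Submodule.span ℝ A : PointedCone ℝ V) := by
    intro v hv
    refine PointedCone.smul_mem _ (ht v hv) ?_
    simp only [Finset.mem_union, Set.Finite.mem_toFinset, Finset.mem_image] at hv
    rcases hv with hv | hv | ⟨w, hw, rfl⟩
    · exact Submodule.mem_sup_left (PointedCone.subset_hull hv)
    · exact Submodule.mem_sup_right (PointedCone.mem_ofSubmodule_iff.2 (Submodule.subset_span hv))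
    · exact Submodule.mem_sup_right (PointedCone.mem_ofSubmodule_iff.2
        (neg_mem (Submodule.subset_span hw)))
  obtain ⟨y, hy, z, hz, hyz⟩ := Submodule.mem_sup.1 (sum_mem hmem)
  exact Set.mem_add.2 ⟨y, hy, z, hz, hyz⟩

end Farkas

/-! ### Local consequences of the active relation -/

section Relation

variable {n ℓ₁ ℓ₂ : ℕ} {a : Fin ℓ₁ ⊕ Fin ℓ₂ → EuclideanSpace ℝ (Fin n)}
  {b : Fin ℓ₁ ⊕ Fin ℓ₂ → ℝ} {x : EuclideanSpace ℝ (Fin n)}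

/-- Strict inequalities at `x` persist for a short time along any line through `x`. -/
theorem eventually_inner_add_smul_lt (d : EuclideanSpace ℝ (Fin n)) {i : Fin ℓ₁ ⊕ Fin ℓ₂}
    (hi : inner ℝ (a i) x < b i) : ∀ᶠ t : ℝ in 𝓝 0, inner ℝ (a i) (x + t • d) < b i := by
  have hc : Continuous fun t : ℝ => inner ℝ (a i) (x + t • d) := by fun_prop
  exact hc.continuousAt.eventually_lt continuousAt_const (by simpa using hi)

/-- Under the active relation, all directions that are feasible for the upper-level constraints
are orthogonal to the active generators of the lower level. -/
theorem ActiveRelation.inner_eq_zero (h : ActiveRelation a b x) (hΘ : x ∈ Theta a b)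
    (hC : x ∈ CSet a b) {d : EuclideanSpace ℝ (Fin n)}
    (hd : ∀ i ∈ active₂ a b x, inner ℝ (a i) d ≤ 0) :
    ∀ i ∈ active₁ a b x, inner ℝ (a i) d = 0 := by
  let F : Set (EuclideanSpace ℝ (Fin n)) :=
    {y | (∀ i ∈ active₁ a b x, inner ℝ (a i) y = 0) ∧ ∀ i ∈ active₂ a b x, inner ℝ (a i) y ≤ 0}
  have hFclosed : IsClosed F := by
    have : F = (⋂ i ∈ active₁ a b x, {y | inner ℝ (a i) y = 0}) ∩
        ⋂ i ∈ active₂ a b x, {y | inner ℝ (a i) y ≤ 0} := by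
      ext y; simp [F]
    rw [this]
    exact (isClosed_biInter fun i _ => isClosed_eq (by fun_prop) continuous_const).inter
      (isClosed_biInter fun i _ => isClosed_le (by fun_prop) continuous_const)
  have hFadd : ∀ y ∈ F, ∀ z ∈ F, y + z ∈ F := by
    intro y hy z hz
    refine ⟨fun i hi => ?_, fun i hi => ?_⟩
    · rw [inner_add_right, hy.1 i hi, hz.1 i hi, add_zero]
    · rw [inner_add_right]
      exact add_nonpos (hy.2 i hi) (hz.2 i hi)
  have hFsmul : ∀ t : ℝ, 0 ≤ t → ∀ y ∈ F, t • y ∈ F := by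
    intro t ht y hy
    refine ⟨fun i hi => ?_, fun i hi => ?_⟩
    · rw [real_inner_smul_right, hy.1 i hi, mul_zero]
    · rw [real_inner_smul_right]
      exact mul_nonpos_of_nonneg_of_nonpos ht (hy.2 i hi)
  have hFconv : Convex ℝ F := fun y hy z hz s t hs ht _ =>
    hFadd _ (hFsmul s hs y hy) _ (hFsmul t ht z hz)
  obtain ⟨q, hq, hmin⟩ := exists_norm_eq_iInf_of_complete_convex
    (⟨0, by simp [F]⟩ : F.Nonempty) hFclosed.isComplete hFconv d
  have hproj := (norm_eq_iInf_iff_real_inner_le_zero hFconv hq).1 hmin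
  let T : Set (Fin ℓ₁ ⊕ Fin ℓ₂) := {i | i ∈ active₂ a b x ∧ inner ℝ (a i) q = 0}
  -- A short step from `x` along `q` lands in the required stratum: inactive constraints stay
  -- strict, those in `T` and the active lower-level ones stay tight, and the remaining active ones
  -- become strict.
  have hT : T ∈ familyI₂ a b x := by
    refine ⟨fun i hi => hi.1, ?_⟩
    have hlt : ∀ᶠ t : ℝ in 𝓝[>] 0, ∀ i, inner ℝ (a i) x < b i → inner ℝ (a i) (x + t • q) < b i :=
      eventually_all.2 fun i => by
        by_cases hi : inner ℝ (a i) x < b i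
        · filter_upwards [nhdsWithin_le_nhds (eventually_inner_add_smul_lt q hi)] with t ht _
          exact ht
        · exact Eventually.of_forall fun t h => absurd h hi
    obtain ⟨t, ht, ht₀⟩ := (hlt.and self_mem_nhdsWithin).exists
    have ht₀ : 0 < t := ht₀
    refine ⟨x + t • q, fun i hi => ?_, fun i hi => ?_⟩
    · rw [inner_add_right, real_inner_smul_right]
      rcases hi with hi | hi
      · rw [hq.1 i hi, hi.2, mul_zero, add_zero]
      · rw [hi.2, hi.1.2, mul_zero, add_zero]
    · by_cases hact : inner ℝ (a i) x = b i
      · rcases i with i | i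
        · exact absurd (Or.inl ⟨⟨i, rfl⟩, hact⟩) hi
        · have hi₂ : (Sum.inr i : Fin ℓ₁ ⊕ Fin ℓ₂) ∈ active₂ a b x := ⟨⟨i, rfl⟩, hact⟩
          have hneg : inner ℝ (a (Sum.inr i)) q < 0 :=
            lt_of_le_of_ne (hq.2 _ hi₂) fun h0 => hi (Or.inr ⟨hi₂, h0⟩)
          rw [inner_add_right, real_inner_smul_right, hact]
          linarith [mul_neg_of_pos_of_neg ht₀ hneg]
      · refine ht i (lt_of_le_of_ne ?_ hact)
        rcases i with i | i
        · exact hΘ i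
        · exact hC i
  have hu : d - q ∈ (PointedCone.hull ℝ (a '' active₂ a b x) : Set (EuclideanSpace ℝ (Fin n))) +
      (Submodule.span ℝ (a '' active₁ a b x) : Set (EuclideanSpace ℝ (Fin n))) := by
    refine mem_hull_add_span_of_forall_inner_nonpos (Set.toFinite _) (Set.toFinite _) ?_
    intro y hy₁ hy₂
    have hy : y ∈ F := ⟨fun i hi => hy₁ _ ⟨i, hi, rfl⟩, fun i hi => hy₂ _ ⟨i, hi, rfl⟩⟩
    -- Since `F` is closed under addition, `q + y` is a valid test point in the variational
    -- inequality of the projection.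
    simpa using hproj (q + y) (hFadd q hq y hy)
  have huT : d - q ∈ coneT a T := fun i hi => by
    rw [inner_sub_right, hi.2, sub_zero]
    exact hd i hi.1
  have h0 : d - q ∈ ({0} : Set (EuclideanSpace ℝ (Fin n))) := by
    rw [← show _ = ({0} : Set (EuclideanSpace ℝ (Fin n))) from h]
    exact ⟨hu, Set.mem_iUnion₂.2 ⟨T, hT, huT⟩⟩
  rw [sub_eq_zero.1 h0]
  exact hq.1

/-- A minimizer `x` of `⟪c, ·⟫` over `Θ` is orthogonally related to the directions along which the
active constraints stay active. -/
theorem inner_eq_zero_of_mem_lowerSolutions {c : EuclideanSpace ℝ (Fin n)}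
    (hx : x ∈ lowerSolutions c (Theta a b)) {d : EuclideanSpace ℝ (Fin n)}
    (hd : ∀ i ∈ active₁ a b x, inner ℝ (a i) d = 0) : inner ℝ c d = 0 := by
  -- The assumption on `d` is symmetric, so one inequality, applied to `d` and `-d`, suffices.
  have key : ∀ d : EuclideanSpace ℝ (Fin n), (∀ i ∈ active₁ a b x, inner ℝ (a i) d = 0) →
      0 ≤ inner ℝ c d := by
    intro d hd
    have hev : ∀ᶠ t : ℝ in 𝓝[>] 0, ∀ i : Fin ℓ₁,
        inner ℝ (a (Sum.inl i)) (x + t • d) ≤ b (Sum.inl i) :=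
      eventually_all.2 fun i => by
        rcases (hx.1 i).lt_or_eq with hi | hi
        · filter_upwards [nhdsWithin_le_nhds (eventually_inner_add_smul_lt d hi)] with t ht
          exact ht.le
        · refine Eventually.of_forall fun t => ?_
          rw [inner_add_right, real_inner_smul_right, hd _ ⟨⟨i, rfl⟩, hi⟩, hi, mul_zero, add_zero]
    obtain ⟨t, ht, ht₀⟩ := (hev.and self_mem_nhdsWithin).exists
    have hle := hx.2 _ ht
    rw [inner_add_right, real_inner_smul_right, le_add_iff_nonneg_right] at hle
    exact nonneg_of_mul_nonneg_right hle ht₀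
  refine le_antisymm ?_ (key d hd)
  have := key (-d) fun i hi => by rw [inner_neg_right, hd i hi, neg_zero]
  rwa [inner_neg_right, Left.nonneg_neg_iff] at this

/-- Under the active relation, the points of `C` near a lower-level solution `x ∈ C` are lower-level
solutions. -/
theorem ActiveRelation.eventually_mem_lowerSolutions (h : ActiveRelation a b x)
    {c : EuclideanSpace ℝ (Fin n)} (hx : x ∈ lowerSolutions c (Theta a b)) (hC : x ∈ CSet a b) :
    ∀ᶠ u in 𝓝[CSet a b] x, u ∈ lowerSolutions c (Theta a b) := by
  have hlt : ∀ᶠ u in 𝓝 x, ∀ i : Fin ℓ₁,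
      inner ℝ (a (Sum.inl i)) x < b (Sum.inl i) → inner ℝ (a (Sum.inl i)) u < b (Sum.inl i) :=
    eventually_all.2 fun i => by
      by_cases hi : inner ℝ (a (Sum.inl i)) x < b (Sum.inl i)
      · have hc : Continuous fun u => inner ℝ (a (Sum.inl i)) u := by fun_prop
        filter_upwards [hc.continuousAt.eventually_lt continuousAt_const hi] with u hu _
        exact hu
      · exact Eventually.of_forall fun u h => absurd h hi
  filter_upwards [nhdsWithin_le_nhds hlt, self_mem_nhdsWithin] with u hu huC
  have hd₁ : ∀ i ∈ active₁ a b x, inner ℝ (a i) (u - x) = 0 := by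
    refine h.inner_eq_zero hx.1 hC ?_
    rintro _ ⟨⟨i, rfl⟩, hi⟩
    rw [inner_sub_right, hi, sub_nonpos]
    exact huC i
  have hcd := inner_eq_zero_of_mem_lowerSolutions hx hd₁
  rw [inner_sub_right, sub_eq_zero] at hcd
  refine ⟨fun i => ?_, fun v hv => hcd ▸ hx.2 v hv⟩
  rcases (hx.1 i).lt_or_eq with hi | hi
  · exact (hu i hi).le
  · have := hd₁ _ ⟨⟨i, rfl⟩, hi⟩
    rw [inner_sub_right, sub_eq_zero] at this
    rw [this, hi]

end Relation

/-! ### Fermat's rule and the conclusion -/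

/-- Fermat's rule: `0 ∈ ∂_C f(x)` at a local minimizer `x` of `f` over `C`. -/
theorem zero_mem_subdifferentialWrt {n : ℕ} {C : Set (EuclideanSpace ℝ (Fin n))}
    {f : EuclideanSpace ℝ (Fin n) → WithTop ℝ} {x : EuclideanSpace ℝ (Fin n)} {r : ℝ}
    (hr : f x = (r : WithTop ℝ)) (hx : x ∈ C) (hmin : IsLocalMinOn f C x) :
    (0 : EuclideanSpace ℝ (Fin n)) ∈ subdifferentialWrt C f x := by
  -- Constant sequences suffice: `(0, -1)` is itself a Fréchet normal at `(x, r)`, and it is radial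
  -- with `p = 1` since moving vertically stays in the cylinder over `C`.
  refine ⟨hx, r, hr, fun _ => WithLp.toLp 2 (x, r), fun _ => WithLp.toLp 2 (0, -1),
    fun _ => ⟨hr.le, hx⟩, tendsto_const_nhds, fun _ => ⟨⟨1, one_pos, ?_⟩, fun ε hε => ?_⟩,
    tendsto_const_nhds⟩
  · simpa using hx
  · have hfst : Tendsto (fun p : WithLp 2 (EuclideanSpace ℝ (Fin n) × ℝ) => p.fst)
        (𝓝[epigraph f ∩ {p | p.fst ∈ C}] WithLp.toLp 2 (x, r)) (𝓝[C] x) := by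
      refine tendsto_nhdsWithin_iff.2 ⟨?_, ?_⟩
      · have hc : Continuous fun p : WithLp 2 (EuclideanSpace ℝ (Fin n) × ℝ) => p.fst := by
          fun_prop
        exact (hc.tendsto (WithLp.toLp 2 (x, r))).mono_left nhdsWithin_le_nhds
      · filter_upwards [self_mem_nhdsWithin] with p hp
        exact hp.2
    filter_upwards [hfst.eventually hmin, self_mem_nhdsWithin] with p hp hpe
    have hle : r ≤ p.snd := by
      have := (hr.symm.le.trans hp).trans hpe.1
      exact_mod_cast this
    have hinner : inner ℝ (WithLp.toLp 2 ((0 : EuclideanSpace ℝ (Fin n)), (-1 : ℝ)))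
        (p - WithLp.toLp 2 (x, r)) = r - p.snd := by
      simp [WithLp.prod_inner_apply]
    rw [hinner]
    exact (sub_nonpos.2 hle).trans (by positivity)

end SBLP

theorem mainTheorem11 {n ℓ₁ ℓ₂ : ℕ}
    (a : Fin ℓ₁ ⊕ Fin ℓ₂ → EuclideanSpace ℝ (Fin n)) (b : Fin ℓ₁ ⊕ Fin ℓ₂ → ℝ)
    (c : EuclideanSpace ℝ (Fin n)) (f : EuclideanSpace ℝ (Fin n) → WithTop ℝ)
    (xbar : EuclideanSpace ℝ (Fin n)) (r : ℝ) (hr : f xbar = (r : WithTop ℝ))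
    (hsol : SBLP.IsRobustLocalSolution f c (SBLP.Theta a b) (SBLP.CSet a b) xbar)
    (hrel : SBLP.ActiveRelation a b xbar)
    (hdense : SBLP.NormalDensed (SBLP.Omega₁ f) (SBLP.Omega₂ c (SBLP.Theta a b))
      (SBLP.cylinder (SBLP.CSet a b)) (SBLP.cylinder (SBLP.CSet a b))
      (WithLp.toLp 2 (xbar, WithLp.toLp 2 ((0 : EuclideanSpace ℝ (Fin n)), r)))) :
    (0 : EuclideanSpace ℝ (Fin n)) ∈ SBLP.subdifferentialWrt (SBLP.CSet a b) f xbar := by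
  obtain ⟨⟨⟨hS, hC⟩, hmin⟩, -⟩ := hsol
  -- Local minimality passes from the bilevel feasible set to the whole upper-level polyhedron,
  -- because the two coincide near `xbar`.
  refine SBLP.zero_mem_subdifferentialWrt hr hC (hmin.filter_mono (le_inf nhdsWithin_le_nhds ?_))
  exact le_principal_iff.2 ((hrel.eventually_mem_lowerSolutions hS hC).and self_mem_nhdsWithin)
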